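/- Let $(\Omega,\Sigma,\mu)$ be a measure space and $\mathcal A\subseteq\Sigma$ a sub-$\sigma$-algebra such that $\mu|_{\mathcal A}$ is $\sigma$-finite. Let $E=E^{\mathcal A}$ be the conditional expectation with respect to $\mathcal A$, defined for all $\Sigma$-measurable $f:\Omega\to[0,\infty]$ (with values in $[0,\infty]$), and by linearity for all $\Sigma$-measurable $f:\Omega\to\mathbb C$ with $E(|f|)<\infty$ a.e. Let $\Phi:\mathbb R\to[0,\infty)$ be a Young function, that is, a continuous, convex, even function with $\Phi(x)=0$ if and only if $x=0$, $\lim_{x\to\infty}\Phi(x)/x=\infty$ and $\lim_{x\to\infty}\Phi(x)=\infty$. Let $\Psi(y)=\sup\{x|y|-\Phi(x):x\ge 0\}$ be the complementary function. For $F\in\{\Phi,\Psi\}$ and $y\in[0,\infty]$ put $F^{-1}(y)=\sup\{x\ge 0: F(x)\le y\}$ (so $F^{-1}(\infty)=\infty$), and for complex-valued $f$ read $F(f)$ as $F(|f|)$. Let $L^{F}(\Sigma)$ be the space of $\Sigma$-measurable $f:\Omega\to\mathbb C$ with $\int_\Omega F(kf)\,d\mu<\infty$ for some $k>0$, with $N_F(f)=\inf\{k>0:\int_\Omega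 F(f/k)\,d\mu\le 1\}$. Let $u:\Omega\to\mathbb C$ be $\Sigma$-measurable and such that $T f=EM_u f=E(uf)$ is well defined for every $f\in L^\Phi(\Sigma)$, that is, $E(|uf|)<\infty$ a.e. Assume that $(E,\Phi)$ satisfies the generalized conditional Hölder inequality: there is a constant $C>0$ such that for all $f\in L^\Phi(\Sigma)$ and $g\in L^\Psi(\Sigma)$ $$E(|fg|)\le C\,\Phi^{-1}\big(E(\Phi(|f|))\big)\,\Psi^{-1}\big(E(\Psi(|g|))\big)\quad\text{a.e.}$$ Assume moreover that at least one of the following holds: (a) $\Phi\in\Delta'$ globally, that is, there is $c>0$ with $\Phi(xy)\le c\,\Phi(x)\Phi(y)$ for all $x,y\ge 0$; (b) $\Psi\prec x$, that is, there are $a\ge0$ and $x_0\ge0$ with $\Psi(x)\le ax$ for all $x\ge x_0$. Then $T$ is bounded on $L^\Phi(\Sigma)$ (it maps $L^\Phi(\Sigma)$ into itself and $N_\Phi(Tf)\le K N_\Phi(f)$ for some constant $K$ and all $f\in L^\Phi(\Sigma)$) if and only if $\Psi^{-1}(E(\Psi(u)))\in L^\infty(\mathcal A)$. -/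

import Mathlib

open MeasureTheory Filter Topology
open scoped ENNReal NNReal

noncomputable section

namespace OrliczCondExp

/-- A Young function: a continuous convex function `Φ : ℝ → [0, ∞)`, vanishing exactly at `0`,
even, with `Φ(x) / x → ∞` and `Φ(x) → ∞` as `x → ∞`. -/
structure IsYoung (Φ : ℝ → ℝ) : Prop where
  nonneg : ∀ x, 0 ≤ Φ x
  continuous : Continuous Φ
  convexOn : ConvexOn ℝ Set.univ Φ
  eq_zero_iff : ∀ x, Φ x = 0 ↔ x = 0
  even : ∀ x, Φ (-x) = Φ x
  tendsto_div : Tendsto (fun x => Φ x / x) atTop atTop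
  tendsto_atTop : Tendsto Φ atTop atTop

/-- The complementary function `Ψ(y) = sup {x|y| - Φ(x) : x ≥ 0}`. For a Young function `Φ` the set
is nonempty and bounded above, so that the supremum is a genuine one. -/
def complementary (Φ : ℝ → ℝ) (y : ℝ) : ℝ :=
  sSup ((fun x : ℝ => x * |y| - Φ x) '' Set.Ici 0)

/-- The inverse on `[0, ∞]` of a nondecreasing function on `[0, ∞)`:
`Φ⁻¹(y) = sup {x ≥ 0 : Φ(x) ≤ y}`, in particular `Φ⁻¹(∞) = ∞`. Where `Φ` is a continuous strictly
increasing bijection of `[0, ∞)` this is the usual inverse function. -/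
def inv (Φ : ℝ → ℝ) (y : ℝ≥0∞) : ℝ≥0∞ :=
  ⨆ (x : ℝ≥0) (_ : ENNReal.ofReal (Φ x) ≤ y), (x : ℝ≥0∞)

/-- The global `Δ'` condition: `Φ(xy) ≤ c Φ(x) Φ(y)` for all `x, y ≥ 0`. -/
def DeltaPrimeGlobally (Φ : ℝ → ℝ) : Prop :=
  ∃ c : ℝ, 0 < c ∧ ∀ x y : ℝ, 0 ≤ x → 0 ≤ y → Φ (x * y) ≤ c * Φ x * Φ y

/-- `Φ₂ ≺ Φ₁`: there are `a ≥ 0` and `x₀ ≥ 0` with `Φ₂(x) ≤ Φ₁(ax)` for all `x ≥ x₀`. -/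
def Weaker (Φ₂ Φ₁ : ℝ → ℝ) : Prop :=
  ∃ a : ℝ, 0 ≤ a ∧ ∃ x₀ : ℝ, 0 ≤ x₀ ∧ ∀ x : ℝ, x₀ ≤ x → Φ₂ x ≤ Φ₁ (a * x)

variable {Ω : Type*}

/-- The composition `Φ(|f|)`, with values in `[0, ∞]`. -/
def comp (Φ : ℝ → ℝ) (f : Ω → ℂ) (ω : Ω) : ℝ≥0∞ :=
  ENNReal.ofReal (Φ ‖f ω‖)

/-- `f ∈ L^Φ(Σ)`: `f` is measurable and `∫ Φ(k|f|) dμ < ∞` for some `k > 0`. -/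
def MemOrlicz {m0 : MeasurableSpace Ω} (μ : Measure Ω) (Φ : ℝ → ℝ) (f : Ω → ℂ) : Prop :=
  Measurable f ∧ ∃ k : ℝ, 0 < k ∧ ∫⁻ ω, ENNReal.ofReal (Φ (k * ‖f ω‖)) ∂μ < ∞

/-- The Luxemburg norm `N_Φ(f) = inf {k > 0 : ∫ Φ(|f| / k) dμ ≤ 1}`. -/
def orliczNorm {m0 : MeasurableSpace Ω} (μ : Measure Ω) (Φ : ℝ → ℝ) (f : Ω → ℂ) : ℝ :=
  sInf {k : ℝ | 0 < k ∧ ∫⁻ ω, ENNReal.ofReal (Φ (‖f ω‖ / k)) ∂μ ≤ 1}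

/-- The conditional expectation of a complex function `f` with `E(|f|) < ∞` almost everywhere
(`f` need not be integrable), obtained from the conditional expectation of nonnegative functions
through the positive and negative parts of the real and imaginary parts. -/
def condExpC (m : MeasurableSpace Ω) {m0 : MeasurableSpace Ω} (μ : Measure Ω) (f : Ω → ℂ)
    (ω : Ω) : ℂ :=
  ⟨(condLExp m μ (fun x => ENNReal.ofReal (f x).re) ω).toReal -
      (condLExp m μ (fun x => ENNReal.ofReal (-(f x).re)) ω).toReal,
    (condLExp m μ (fun x => ENNReal.ofReal (f x).im) ω).toReal -
      (condLExp m μ (fun x => ENNReal.ofReal (-(f x).im)) ω).toReal⟩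

/-- The operator `T = E M_u`, `T f = E(u f)`. -/
def condMul (m : MeasurableSpace Ω) {m0 : MeasurableSpace Ω} (μ : Measure Ω) (u f : Ω → ℂ) :
    Ω → ℂ :=
  condExpC m μ (fun x => u x * f x)

/-- `T = E M_u` is well defined on `L^Φ(Σ)`: for every `f` in that space, `u f` is in the domain of
the conditional expectation, that is `E(|u f|) < ∞` almost everywhere. -/
def WellDefined (m : MeasurableSpace Ω) {m0 : MeasurableSpace Ω} (μ : Measure Ω) (Φ : ℝ → ℝ)
    (u : Ω → ℂ) : Prop :=
  ∀ f : Ω → ℂ, MemOrlicz μ Φ f → ∀ᵐ ω ∂μ, condLExp m μ (fun x => ‖u x * f x‖ₑ) ω < ∞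

/-- `T` maps `L^Φ(Σ)` into itself and is bounded for the norm `N_Φ`. -/
def IsBoundedOn {m0 : MeasurableSpace Ω} (μ : Measure Ω) (Φ : ℝ → ℝ)
    (T : (Ω → ℂ) → (Ω → ℂ)) : Prop :=
  ∃ K : ℝ, ∀ f : Ω → ℂ, MemOrlicz μ Φ f →
    MemOrlicz μ Φ (T f) ∧ orliczNorm μ Φ (T f) ≤ K * orliczNorm μ Φ f

/-- The generalized conditional Hölder inequality for `(E, Φ)`: there is `C > 0` with
`E(|fg|) ≤ C Φ⁻¹(E(Φ(|f|))) Ψ⁻¹(E(Ψ(|g|)))` almost everywhere, for all `f ∈ L^Φ(Σ)` and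
`g ∈ L^Ψ(Σ)`, where `Ψ` is complementary to `Φ`. -/
def GenCondHolder (m : MeasurableSpace Ω) {m0 : MeasurableSpace Ω} (μ : Measure Ω)
    (Φ : ℝ → ℝ) : Prop :=
  ∃ C : ℝ≥0, 0 < C ∧ ∀ f g : Ω → ℂ, MemOrlicz μ Φ f → MemOrlicz μ (complementary Φ) g →
    ∀ᵐ ω ∂μ, condLExp m μ (fun x => ‖f x * g x‖ₑ) ω ≤
      C * inv Φ (condLExp m μ (comp Φ f) ω) *
        inv (complementary Φ) (condLExp m μ (comp (complementary Φ) g) ω)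

end OrliczCondExp

end

/-! Since `Φ` is finite everywhere, `Ψ` grows superlinearly. So alternative (b) never occurs
(`IsYoung.not_weaker_complementary`) and `Δ'` is always available.

Sufficiency: if `Ψ⁻¹(E(Ψ(u))) ≤ M`, the Hölder inequality, localised in `condLExp_enorm_mul_le`,
gives `E(|uf|) ≤ C M Φ⁻¹(E(Φ(f)))`. Dividing by a constant, applying `Φ` and integrating removes `E`
and bounds `T`.

Necessity: a bounded `T` together with `Δ'` forces `E(|u| f) ≤ L` whenever `E(Φ(f)) ≤ 1`; otherwise
a test function on a small set of `𝒜` violates the norm bound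
(`IsBoundedOn.exists_condLExp_mul_le`). A conditional form of Orlicz duality
(`IsYoung.condLExp_complementary_le`) turns this into `E(Ψ(|u|/L)) ≤ 1`. The factor `1/L` cannot be
removed by a growth condition on `Ψ`. Instead the Hölder inequality is applied to `f` and `|u|/L`:
it bounds `E(|u| f)` by `L C b X` whenever `E(Φ(f)) ≤ Φ(X)`, and for large `X` this is at most
`Φ(X)`. A second use of duality, at level `Φ(X)`, yields `E(Ψ(u)) ≤ Φ(X)`. All this is done for
truncations of `|u|`, followed by a monotone limit. -/

namespace OrliczCondExp

/-! ### Young functions and their complementary functions -/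

section Young

variable {Φ : ℝ → ℝ}

theorem IsYoung.map_zero (h : IsYoung Φ) : Φ 0 = 0 := (h.eq_zero_iff 0).2 rfl

theorem IsYoung.pos (h : IsYoung Φ) {x : ℝ} (hx : x ≠ 0) : 0 < Φ x :=
  lt_of_le_of_ne (h.nonneg x) fun h0 => hx ((h.eq_zero_iff x).1 h0.symm)

theorem IsYoung.map_mul_le (h : IsYoung Φ) {r : ℝ} (hr : 0 ≤ r) (hr1 : r ≤ 1) (x : ℝ) :
    Φ (r * x) ≤ r * Φ x := by
  have := h.convexOn.2 (Set.mem_univ x) (Set.mem_univ 0) hr (sub_nonneg.2 hr1) (by ring)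
  simpa [h.map_zero] using this

theorem IsYoung.mul_le_map_mul (h : IsYoung Φ) {s : ℝ} (hs : 1 ≤ s) (x : ℝ) :
    s * Φ x ≤ Φ (s * x) := by
  have hs0 : 0 < s := by linarith
  have := h.map_mul_le (inv_nonneg.2 hs0.le) (inv_le_one_of_one_le₀ hs) (s * x)
  rw [inv_mul_cancel_left₀ hs0.ne'] at this
  calc s * Φ x ≤ s * (s⁻¹ * Φ (s * x)) := by gcongr
    _ = Φ (s * x) := mul_inv_cancel_left₀ hs0.ne' _

theorem IsYoung.strictMonoOn (h : IsYoung Φ) : StrictMonoOn Φ (Set.Ici 0) := by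
  intro x hx y _ hxy
  rcases eq_or_lt_of_le (show 0 ≤ x from hx) with rfl | hx0
  · rw [h.map_zero]
    exact h.pos hxy.ne'
  · have h1 := h.mul_le_map_mul (s := y / x) (by rw [one_le_div hx0]; exact hxy.le) x
    rw [div_mul_cancel₀ _ hx0.ne'] at h1
    have h2 : 1 < y / x := by rwa [one_lt_div hx0]
    nlinarith [h.pos hx0.ne']

theorem IsYoung.mono (h : IsYoung Φ) {x y : ℝ} (hx : 0 ≤ x) (hxy : x ≤ y) : Φ x ≤ Φ y :=
  h.strictMonoOn.monotoneOn hx (hx.trans hxy) hxy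

theorem IsYoung.exists_mul_le (h : IsYoung Φ) (a : ℝ) :
    ∃ X : ℝ, 0 < X ∧ ∀ x, X ≤ x → a * x ≤ Φ x := by
  obtain ⟨X, hX⟩ := (eventually_atTop).1 (h.tendsto_div.eventually_ge_atTop a)
  refine ⟨max X 1, by positivity, fun x hx => ?_⟩
  have hx0 : 0 < x := lt_of_lt_of_le one_pos ((le_max_right _ _).trans hx)
  exact (le_div_iff₀ hx0).1 (hX x ((le_max_left _ _).trans hx))

/-- Superlinear growth makes the value nonpositive beyond some `X`, hence no better than at `0`;
compactness of `[0, X]` does the rest. -/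
theorem IsYoung.exists_isMaxOn (h : IsYoung Φ) (y : ℝ) :
    ∃ x : ℝ, 0 ≤ x ∧ ∀ x', 0 ≤ x' → x' * y - Φ x' ≤ x * y - Φ x := by
  obtain ⟨X, hX0, hX⟩ := h.exists_mul_le y
  obtain ⟨x, hx, hmax⟩ := (isCompact_Icc (a := (0 : ℝ)) (b := X)).exists_isMaxOn
    ⟨0, by simp [hX0.le]⟩ (f := fun x => x * y - Φ x)
    ((continuous_id.mul continuous_const).sub h.continuous).continuousOn
  refine ⟨x, hx.1, fun x' hx' => ?_⟩
  by_cases hle : x' ≤ X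
  · exact hmax ⟨hx', hle⟩
  · have h0 := hmax (show (0 : ℝ) ∈ Set.Icc 0 X by simp [hX0.le])
    simp only [Set.mem_ofPred_eq, zero_mul, h.map_zero, sub_zero] at h0
    nlinarith [hX x' (not_le.1 hle).le]

/-- A measurable selection of a point where the supremum defining the complementary function is
attained. -/
theorem IsYoung.exists_measurable_maximizer (h : IsYoung Φ) :
    ∃ p : ℝ → ℝ, Measurable p ∧ (∀ y, 0 ≤ p y) ∧ p 0 = 0 ∧
      (∀ x y, 0 ≤ x → x ≤ y → p x ≤ p y) ∧
      ∀ y, 0 ≤ y → y * p y = Φ (p y) + complementary Φ y := by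
  choose q hq0 hq using h.exists_isMaxOn
  -- Adding the two optimality inequalities gives `(y₂ - y₁)(q y₂ - q y₁) ≥ 0`, so any choice of
  -- maximizers is monotone and therefore measurable.
  have hmono : Monotone q := by
    intro y₁ y₂ hy
    rcases eq_or_lt_of_le hy with rfl | hlt
    · exact le_rfl
    · nlinarith [hq y₁ (q y₂) (hq0 _), hq y₂ (q y₁) (hq0 _)]
  have hz : q 0 = 0 := by
    by_contra hne
    have := hq 0 0 le_rfl
    simp only [mul_zero, h.map_zero, zero_sub, neg_zero] at this
    linarith [h.pos hne]
  refine ⟨q, hmono.measurable, hq0, hz, fun x y _ hxy => hmono hxy, fun y hy => ?_⟩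
  have : IsGreatest ((fun x : ℝ => x * |y| - Φ x) '' Set.Ici 0) (q y * |y| - Φ (q y)) := by
    refine ⟨⟨q y, hq0 y, rfl⟩, ?_⟩
    rintro _ ⟨x, hx, rfl⟩
    rw [abs_of_nonneg hy]
    exact hq y x hx
  rw [complementary, this.csSup_eq, abs_of_nonneg hy]
  ring

theorem IsYoung.sub_le_complementary (h : IsYoung Φ) {x : ℝ} (hx : 0 ≤ x) (y : ℝ) :
    x * |y| - Φ x ≤ complementary Φ y := by
  obtain ⟨z, -, hz⟩ := h.exists_isMaxOn |y|
  refine le_csSup ⟨z * |y| - Φ z, ?_⟩ ⟨x, hx, rfl⟩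
  rintro _ ⟨x, hx, rfl⟩
  exact hz x hx

theorem IsYoung.complementary_nonneg (h : IsYoung Φ) (y : ℝ) : 0 ≤ complementary Φ y := by
  simpa [h.map_zero] using h.sub_le_complementary le_rfl y

theorem IsYoung.complementary_mono (h : IsYoung Φ) {x y : ℝ} (hx : 0 ≤ x) (hxy : x ≤ y) :
    complementary Φ x ≤ complementary Φ y := by
  refine csSup_le ⟨_, ⟨0, le_refl (0 : ℝ), rfl⟩⟩ ?_
  rintro _ ⟨z, hz, rfl⟩
  refine le_trans ?_ (h.sub_le_complementary hz y)
  rw [abs_of_nonneg hx, abs_of_nonneg (hx.trans hxy)]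
  have : z * x ≤ z * y := mul_le_mul_of_nonneg_left hxy hz
  simpa using this

theorem IsYoung.complementary_zero (h : IsYoung Φ) : complementary Φ 0 = 0 := by
  refine le_antisymm (csSup_le ⟨_, ⟨0, le_refl (0 : ℝ), rfl⟩⟩ ?_) (h.complementary_nonneg 0)
  rintro _ ⟨z, -, rfl⟩
  simpa using h.nonneg z

theorem IsYoung.measurable_complementary (h : IsYoung Φ) : Measurable (complementary Φ) := by
  have hmono : Monotone fun y => complementary Φ (max y 0) := fun a b hab =>
    h.complementary_mono (le_max_right _ _) (max_le_max_right _ hab)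
  have : complementary Φ = fun y => complementary Φ (max |y| 0) := by
    ext y
    simp [complementary, abs_nonneg]
  rw [this]
  exact hmono.measurable.comp measurable_abs

theorem IsYoung.exists_lt_complementary (h : IsYoung Φ) (R : ℝ) :
    ∃ X : ℝ, 0 ≤ X ∧ R < complementary Φ X := by
  refine ⟨|R| + Φ 1 + 1, by have := h.nonneg 1; positivity, ?_⟩
  refine lt_of_lt_of_le ?_ (h.sub_le_complementary zero_le_one _)
  rw [abs_of_nonneg (by have := h.nonneg 1; positivity)]
  linarith [le_abs_self R]

/-- Young's inequality at `a + 1` puts the line `(a + 1) y - Φ(a + 1)` below `Ψ`, and this line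
exceeds `a y` once `y > Φ(a + 1)`. -/
theorem IsYoung.not_weaker_complementary (h : IsYoung Φ) :
    ¬ Weaker (complementary Φ) fun x => x := by
  rintro ⟨a, ha, x₀, hx₀, hle⟩
  have h1 := hle (max x₀ (Φ (a + 1) + 1)) (le_max_left _ _)
  have h2 := h.sub_le_complementary (x := a + 1) (by linarith) (max x₀ (Φ (a + 1) + 1))
  rw [abs_of_nonneg (le_max_of_le_left hx₀)] at h2
  have h3 := le_max_right x₀ (Φ (a + 1) + 1)
  simp only at h1
  nlinarith

theorem IsYoung.exists_map_eq (h : IsYoung Φ) {a : ℝ} (ha : 0 < a) : ∃ t : ℝ, 0 < t ∧ Φ t = a := by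
  obtain ⟨X, hX0, hX⟩ := (h.tendsto_atTop.eventually_ge_atTop a).and
    (eventually_ge_atTop (0 : ℝ)) |>.exists
  obtain ⟨t, ht, hta⟩ := intermediate_value_Icc hX h.continuous.continuousOn
    (show a ∈ Set.Icc (Φ 0) (Φ X) by rw [h.map_zero]; exact ⟨ha.le, hX0⟩)
  refine ⟨t, lt_of_le_of_ne ht.1 ?_, hta⟩
  rintro rfl
  rw [h.map_zero] at hta
  exact ha.ne hta

end Young

/-! ### The generalized inverse -/

section Inverse

variable {F : ℝ → ℝ}

theorem inv_mono : Monotone (inv F) := fun _ _ hab =>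
  iSup_mono fun _ => iSup_mono' fun h => ⟨h.trans hab, le_rfl⟩

theorem inv_le_of_forall {y : ℝ≥0∞} {X : ℝ} (hX : ∀ x, X < x → y < ENNReal.ofReal (F x)) :
    inv F y ≤ ENNReal.ofReal X := by
  refine iSup₂_le fun x hx => ?_
  by_contra hlt
  refine absurd hx (not_le.2 (hX x ?_))
  rw [not_le, ENNReal.ofReal, ENNReal.coe_lt_coe] at hlt
  exact Real.lt_of_toNNReal_lt (by rwa [Real.toNNReal_coe])

theorem ofReal_le_inv {y : ℝ≥0∞} {x : ℝ} (hx : 0 ≤ x) (h : ENNReal.ofReal (F x) ≤ y) :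
    ENNReal.ofReal x ≤ inv F y := by
  have : ENNReal.ofReal (F (⟨x, hx⟩ : ℝ≥0)) ≤ y := h
  refine le_trans ?_ (le_iSup₂ (f := fun (z : ℝ≥0) (_ : ENNReal.ofReal (F z) ≤ y) => (z : ℝ≥0∞))
    ⟨x, hx⟩ this)
  rw [ENNReal.ofReal_eq_coe_nnreal hx]
  exact le_rfl

/-- Every `s < r` lies below an admissible point of the supremum, so `F s ≤ y`; continuity from the
left passes to `r`. -/
theorem IsYoung.ofReal_map_le_of_le_inv (h : IsYoung F) {y : ℝ≥0∞} {r : ℝ} (hr : 0 ≤ r)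
    (hle : ENNReal.ofReal r ≤ inv F y) : ENNReal.ofReal (F r) ≤ y := by
  rcases eq_or_lt_of_le hr with rfl | hr0
  · simp [h.map_zero]
  have hlim : Tendsto (fun s => ENNReal.ofReal (F s)) (𝓝[<] r) (𝓝 (ENNReal.ofReal (F r))) :=
    ((ENNReal.continuous_ofReal.comp h.continuous).tendsto r).mono_left nhdsWithin_le_nhds
  refine le_of_tendsto hlim ?_
  filter_upwards [Ioo_mem_nhdsLT hr0] with s hs
  have hlt : ENNReal.ofReal s < inv F y :=
    lt_of_lt_of_le ((ENNReal.ofReal_lt_ofReal_iff hr0).2 hs.2) hle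
  simp only [inv, lt_iSup_iff] at hlt
  obtain ⟨x, hx, hsx⟩ := hlt
  refine le_trans (ENNReal.ofReal_le_ofReal (h.mono hs.1.le ?_)) hx
  rw [ENNReal.ofReal, ENNReal.coe_lt_coe] at hsx
  exact Real.toNNReal_le_iff_le_coe.1 hsx.le

theorem IsYoung.inv_map_le (h : IsYoung F) {X : ℝ} (hX : 0 ≤ X) :
    inv F (ENNReal.ofReal (F X)) ≤ ENNReal.ofReal X := by
  refine inv_le_of_forall fun x hx => ?_
  have hlt := h.strictMonoOn hX (hX.trans hx.le) hx
  exact (ENNReal.ofReal_lt_ofReal_iff (lt_of_le_of_lt (h.nonneg X) hlt)).2 hlt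

end Inverse

/-! ### Test functions and conditional expectations with values in `[0, ∞]` -/

/-- Nonnegative bounded measurable functions vanishing off `S`. -/
structure IsTest {Ω : Type*} [MeasurableSpace Ω] (S : Set Ω) (f : Ω → ℝ) : Prop where
  measurable : Measurable f
  nonneg : ∀ ω, 0 ≤ f ω
  bounded : ∃ B, ∀ ω, f ω ≤ B
  eq_zero : ∀ ω, ω ∉ S → f ω = 0

variable {Ω : Type*} {m m0 : MeasurableSpace Ω}

/-- The measures with densities `E(X)` and `X` agree on `𝒜`, so they integrate every `𝒜`-measurable
`a` equally. -/
theorem setLIntegral_mul_condLExp (hm : m ≤ m0) (μ : Measure[m0] Ω) [SigmaFinite (μ.trim hm)]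
    {a X : Ω → ℝ≥0∞} (ha : Measurable[m] a) (hX : Measurable[m0] X) {s : Set Ω}
    (hs : MeasurableSet[m] s) :
    ∫⁻ ω in s, a ω * condLExp m μ X ω ∂μ = ∫⁻ ω in s, a ω * X ω ∂μ := by
  have key : (μ.withDensity (condLExp m μ X)).trim hm = (μ.withDensity X).trim hm := by
    refine @Measure.ext _ m _ _ fun t ht => ?_
    rw [trim_measurableSet_eq hm ht, trim_measurableSet_eq hm ht, withDensity_apply _ (hm t ht),
      withDensity_apply _ (hm t ht), setLIntegral_condLExp hm μ X ht]
  have expand : ∀ Y : Ω → ℝ≥0∞, Measurable[m0] Y →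
      ∫⁻ ω in s, a ω * Y ω ∂μ = ∫⁻ ω in s, a ω ∂(μ.withDensity Y).trim hm := by
    intro Y hY
    rw [setLIntegral_trim hm ha hs,
      setLIntegral_withDensity_eq_setLIntegral_mul μ hY (ha.mono hm le_rfl) (hm s hs)]
    simp only [Pi.mul_apply, mul_comm]
  rw [expand _ (measurable_condLExp' m μ X), expand X hX, key]

/-- The pull-out property of the conditional Lebesgue expectation. -/
theorem condLExp_mul_left (hm : m ≤ m0) (μ : Measure[m0] Ω) [SigmaFinite (μ.trim hm)]
    {a X : Ω → ℝ≥0∞} (ha : Measurable[m] a) (hX : Measurable[m0] X) :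
    condLExp m μ (fun ω => a ω * X ω) =ᵐ[μ] fun ω => a ω * condLExp m μ X ω :=
  (ae_eq_condLExp hm μ _ (ha.mul (measurable_condLExp m μ X)) fun _ hs =>
    setLIntegral_mul_condLExp hm μ ha hX hs).symm

/-- Monotone convergence is applied to integrals over sets of `𝒜`; σ-finiteness then recovers the
pointwise bound. -/
theorem condLExp_le_const_of_iSup (hm : m ≤ m0) (μ : Measure[m0] Ω) [SigmaFinite (μ.trim hm)]
    {X : ℕ → Ω → ℝ≥0∞} {Y : Ω → ℝ≥0∞} (hX : ∀ n, Measurable[m0] (X n)) (hmono : Monotone X)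
    (hY : ∀ ω, Y ω = ⨆ n, X n ω) {R : ℝ≥0∞} (hR : ∀ n, ∀ᵐ ω ∂μ, condLExp m μ (X n) ω ≤ R) :
    ∀ᵐ ω ∂μ.trim hm, condLExp m μ Y ω ≤ R := by
  refine ae_le_of_forall_setLIntegral_le_of_sigmaFinite (μ := μ.trim hm) (g := fun _ => R)
    (measurable_condLExp m μ Y) fun s hs _ => ?_
  rw [setLIntegral_condLExp_trim hm μ Y hs]
  simp only [hY]
  rw [lintegral_iSup hX hmono]
  refine iSup_le fun n => ?_
  rw [← setLIntegral_condLExp hm μ (X n) hs, setLIntegral_const, trim_measurableSet_eq hm hs,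
    ← setLIntegral_const]
  exact lintegral_mono_ae (ae_restrict_of_ae (hR n))

theorem lintegral_map_lt_top (μ : Measure[m0] Ω) {G : ℝ → ℝ} (hG0 : G 0 = 0)
    (hG : ∀ x y, 0 ≤ x → x ≤ y → G x ≤ G y) {S : Set Ω} (hS : μ S < ∞)
    (hSm : MeasurableSet[m0] S) {f : Ω → ℝ} {B : ℝ} (hf0 : ∀ ω, 0 ≤ f ω) (hfB : ∀ ω, f ω ≤ B)
    (hfS : ∀ ω, ω ∉ S → f ω = 0) : ∫⁻ ω, ENNReal.ofReal (G (f ω)) ∂μ < ∞ := by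
  calc ∫⁻ ω, ENNReal.ofReal (G (f ω)) ∂μ
      ≤ ∫⁻ ω, S.indicator (fun _ => ENNReal.ofReal (G B)) ω ∂μ := by
        refine lintegral_mono fun ω => ?_
        by_cases hω : ω ∈ S
        · rw [Set.indicator_of_mem hω]
          exact ENNReal.ofReal_le_ofReal (hG _ _ (hf0 ω) (hfB ω))
        · simp [hfS ω hω, hG0]
    _ = ENNReal.ofReal (G B) * μ S := by rw [lintegral_indicator hSm, setLIntegral_const]
    _ < ∞ := ENNReal.mul_lt_top ENNReal.ofReal_lt_top hS

theorem IsTest.memOrlicz {μ : Measure[m0] Ω} {G : ℝ → ℝ} (hG0 : G 0 = 0)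
    (hG : ∀ x y, 0 ≤ x → x ≤ y → G x ≤ G y) {S : Set Ω} (hS : μ S < ∞)
    (hSm : MeasurableSet[m0] S) {f : Ω → ℝ} (hf : IsTest S f) :
    MemOrlicz μ G fun ω => (f ω : ℂ) := by
  obtain ⟨B, hB⟩ := hf.bounded
  refine ⟨Complex.measurable_ofReal.comp hf.measurable, 1, one_pos, ?_⟩
  have hn : ∀ ω, (1 : ℝ) * ‖(f ω : ℂ)‖ = f ω := fun ω => by
    rw [one_mul, Complex.norm_real, Real.norm_of_nonneg (hf.nonneg ω)]
  simp only [hn]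
  exact lintegral_map_lt_top μ hG0 hG hS hSm hf.nonneg hB hf.eq_zero

/-! ### Conditional duality -/

/-- Conditional duality: if `E(v f) ≤ y` whenever `E(Φ(f)) ≤ y`, then `E(Ψ(v)) ≤ y`. -/
theorem IsYoung.condLExp_complementary_le {Φ : ℝ → ℝ} (hΦ : IsYoung Φ) (hm : m ≤ m0)
    (μ : Measure[m0] Ω) [SigmaFinite (μ.trim hm)] {S : Set Ω} (hS : μ S < ∞)
    (hSm : MeasurableSet[m0] S) {v : Ω → ℝ} (hv : IsTest S v) {y : ℝ} (hy : 0 < y)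
    (H : ∀ f : Ω → ℝ, IsTest S f →
      (∀ᵐ ω ∂μ, condLExp m μ (fun x => ENNReal.ofReal (Φ (f x))) ω ≤ ENNReal.ofReal y) →
      ∀ᵐ ω ∂μ, condLExp m μ (fun x => ENNReal.ofReal (v x * f x)) ω ≤ ENNReal.ofReal y) :
    ∀ᵐ ω ∂μ, condLExp m μ (fun x => ENNReal.ofReal (complementary Φ (v x))) ω
      ≤ ENNReal.ofReal y := by
  obtain ⟨p, hpm, hp0, hpz, hpmono, hp⟩ := hΦ.exists_measurable_maximizer
  obtain ⟨B, hB⟩ := hv.bounded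
  -- The equality case of Young's inequality: `v f₀ = Φ(f₀) + Ψ(v)`.
  set f₀ : Ω → ℝ := fun ω => p (v ω) with hf₀
  have hf₀S : ∀ ω, ω ∉ S → f₀ ω = 0 := fun ω hω => by simp [hf₀, hv.eq_zero ω hω, hpz]
  have hf₀B : ∀ ω, f₀ ω ≤ p B := fun ω => hpmono _ _ (hv.nonneg ω) (hB ω)
  have hf₀m : Measurable[m0] f₀ := hpm.comp hv.measurable
  set P : Ω → ℝ≥0∞ := fun ω => ENNReal.ofReal (Φ (f₀ ω)) with hP
  have hPm : Measurable[m0] P := (hΦ.continuous.measurable.comp hf₀m).ennreal_ofReal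
  have hvfm : Measurable[m0] fun ω => ENNReal.ofReal (v ω * f₀ ω) :=
    (hv.measurable.mul hf₀m).ennreal_ofReal
  set D := condLExp m μ P with hD
  have hDm : Measurable[m] D := measurable_condLExp m μ P
  -- An `𝒜`-measurable normalisation: by convexity `E(Φ(r f₀)) ≤ r D ≤ y`, so `r f₀` is admissible
  -- in `H`, and `r` can be pulled out of `E`.
  set r : Ω → ℝ≥0∞ := fun ω => (max 1 (D ω / ENNReal.ofReal y))⁻¹ with hr
  have hrm : Measurable[m] r := by
    refine Measurable.inv (Measurable.max measurable_const (Measurable.div_const hDm _))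
  have hr1 : ∀ ω, r ω ≤ 1 := fun ω => ENNReal.inv_le_one.2 (le_max_left _ _)
  have hrtop : ∀ ω, r ω ≠ ∞ := fun ω => ne_top_of_le_ne_top ENNReal.one_ne_top (hr1 ω)
  have hrr1 : ∀ ω, (r ω).toReal ≤ 1 := fun ω => by
    simpa using ENNReal.toReal_mono ENNReal.one_ne_top (hr1 ω)
  have hy0 : ENNReal.ofReal y ≠ 0 := by simpa using hy
  have hrD : ∀ ω, r ω * D ω ≤ ENNReal.ofReal y := by
    intro ω
    rw [mul_comm, ← div_eq_mul_inv]
    refine ENNReal.div_le_of_le_mul ?_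
    calc D ω = ENNReal.ofReal y * (D ω / ENNReal.ofReal y) :=
          (ENNReal.mul_div_cancel hy0 ENNReal.ofReal_ne_top).symm
      _ ≤ _ := by gcongr; exact le_max_right _ _
  have hf : IsTest S fun ω => (r ω).toReal * f₀ ω := by
    refine ⟨((hrm.mono hm le_rfl).ennreal_toReal).mul hf₀m,
      fun ω => mul_nonneg ENNReal.toReal_nonneg (hp0 _), ⟨p B, fun ω => ?_⟩,
      fun ω hω => by simp [hf₀S ω hω]⟩
    exact (mul_le_of_le_one_left (hp0 _) (hrr1 ω)).trans (hf₀B ω)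
  have h1 : ∀ᵐ ω ∂μ, condLExp m μ (fun x => ENNReal.ofReal (Φ ((r x).toReal * f₀ x))) ω
      ≤ ENNReal.ofReal y := by
    have hle : ∀ x, ENNReal.ofReal (Φ ((r x).toReal * f₀ x)) ≤ r x * P x := by
      intro x
      refine (ENNReal.ofReal_le_ofReal
        (hΦ.map_mul_le ENNReal.toReal_nonneg (hrr1 x) _)).trans ?_
      rw [ENNReal.ofReal_mul ENNReal.toReal_nonneg, ENNReal.ofReal_toReal (hrtop x)]
    filter_upwards [condLExp_mono (mΩ := m) (ae_of_all μ hle), condLExp_mul_left hm μ hrm hPm]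
      with ω h2 h3
    rw [h3] at h2
    exact h2.trans (hrD ω)
  have h2 := H _ hf h1
  have h3 : (fun x => ENNReal.ofReal (v x * ((r x).toReal * f₀ x)))
      = fun x => r x * ENNReal.ofReal (v x * f₀ x) := by
    ext x
    rw [mul_left_comm, ENNReal.ofReal_mul ENNReal.toReal_nonneg, ENNReal.ofReal_toReal (hrtop x)]
  rw [h3] at h2
  have h4 : (fun x => ENNReal.ofReal (v x * f₀ x))
      = P + fun x => ENNReal.ofReal (complementary Φ (v x)) := by
    ext x
    rw [hf₀, hp _ (hv.nonneg x), ENNReal.ofReal_add (hΦ.nonneg _) (hΦ.complementary_nonneg _)]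
    rfl
  have hfin : ∀ᵐ ω ∂μ, D ω < ∞ := condLExp_lt_top
    (lintegral_map_lt_top μ hΦ.map_zero (fun _ _ => hΦ.mono) hS hSm (fun _ => hp0 _) hf₀B hf₀S).ne
  filter_upwards [h2, condLExp_mul_left hm μ hrm hvfm, hfin,
    condLExp_add_left (mΩ := m) (P := μ) (X := P)
      (fun x => ENNReal.ofReal (complementary Φ (v x))) hPm.aemeasurable] with ω h5 h6 h7 h8
  rw [h6, h4, h8, Pi.add_apply] at h5
  have hmax0 : max 1 (D ω / ENNReal.ofReal y) ≠ 0 := (lt_max_of_lt_left one_pos).ne'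
  have hmaxt : max 1 (D ω / ENNReal.ofReal y) ≠ ∞ :=
    (max_lt ENNReal.one_lt_top (ENNReal.div_lt_top h7.ne hy0)).ne
  have h9 : D ω + condLExp m μ (fun x => ENNReal.ofReal (complementary Φ (v x))) ω
      ≤ max (ENNReal.ofReal y) (D ω) := by
    calc _ = max 1 (D ω / ENNReal.ofReal y) * (r ω * (D ω + _)) := by
          rw [← mul_assoc, ENNReal.mul_inv_cancel hmax0 hmaxt, one_mul]
      _ ≤ max 1 (D ω / ENNReal.ofReal y) * ENNReal.ofReal y := by gcongr
      _ = _ := by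
          rw [max_mul_of_nonneg _ _ zero_le, one_mul, ENNReal.div_mul_cancel hy0
            ENNReal.ofReal_ne_top]
  -- Where `D ≥ y`, cancelling the finite `D` even forces `E(Ψ(v)) = 0`.
  rcases le_total (D ω) (ENNReal.ofReal y) with hc | hc
  · rw [max_eq_left hc] at h9
    exact le_trans le_add_self h9
  · rw [max_eq_right hc] at h9
    have : condLExp m μ (fun x => ENNReal.ofReal (complementary Φ (v x))) ω ≤ 0 :=
      (ENNReal.add_le_add_iff_left h7.ne).1 (by simpa using h9)
    exact this.trans zero_le

/-! ### Complex conditional expectation and the Luxemburg norm -/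

theorem measurable_condExpC (μ : Measure[m0] Ω) (h : Ω → ℂ) :
    Measurable[m0] (condExpC m μ h) := by
  have hmeas : ∀ X : Ω → ℝ≥0∞, Measurable[m0] fun ω => (condLExp m μ X ω).toReal := fun X =>
    (measurable_condLExp' m μ X).ennreal_toReal
  exact Complex.measurableEquivRealProd.symm.measurable.comp
    (((hmeas _).sub (hmeas _)).prodMk ((hmeas _).sub (hmeas _)))

/-- The real and imaginary parts contribute at most `E(|h|)` each, whence the factor `2`. -/
theorem ofReal_norm_condExpC_le (μ : Measure[m0] Ω) (h : Ω → ℂ) :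
    ∀ᵐ ω ∂μ, ENNReal.ofReal ‖condExpC m μ h ω‖ ≤ 2 * condLExp m μ (fun x => ‖h x‖ₑ) ω := by
  have hmono : ∀ X : Ω → ℝ, (∀ x, X x ≤ ‖h x‖) →
      ∀ᵐ ω ∂μ, condLExp m μ (fun x => ENNReal.ofReal (X x)) ω
        ≤ condLExp m μ (fun x => ‖h x‖ₑ) ω := fun X hX =>
    condLExp_mono (ae_of_all μ fun x => by
      simp only [← ofReal_norm]
      exact ENNReal.ofReal_le_ofReal (hX x))
  filter_upwards [hmono (fun x => (h x).re) fun x => Complex.re_le_norm _,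
    hmono (fun x => -(h x).re) fun x => (neg_le_abs _).trans (Complex.abs_re_le_norm _),
    hmono (fun x => (h x).im) fun x => Complex.im_le_norm _,
    hmono (fun x => -(h x).im) fun x => (neg_le_abs _).trans (Complex.abs_im_le_norm _)]
    with ω h1 h2 h3 h4
  by_cases htop : condLExp m μ (fun x => ‖h x‖ₑ) ω = ∞
  · simp [htop]
  have hsub : ∀ {a b : ℝ≥0∞}, a ≤ condLExp m μ (fun x => ‖h x‖ₑ) ω →
      b ≤ condLExp m μ (fun x => ‖h x‖ₑ) ω →
      |a.toReal - b.toReal| ≤ (condLExp m μ (fun x => ‖h x‖ₑ) ω).toReal := by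
    intro a b ha hb
    have ha' := ENNReal.toReal_mono htop ha
    have hb' := ENNReal.toReal_mono htop hb
    rw [abs_le]
    constructor <;> linarith [a.toReal_nonneg, b.toReal_nonneg]
  refine ENNReal.ofReal_le_of_le_toReal ((Complex.norm_le_abs_re_add_abs_im _).trans ?_)
  rw [ENNReal.toReal_mul, ENNReal.toReal_ofNat, two_mul]
  exact add_le_add (hsub h1 h2) (hsub h3 h4)

/-- If `∫ Φ(k|f|) = I`, convexity lets the scale `k / (1 + I)` bring the integral below `1`. This
makes the infimum in the norm a genuine one. -/
theorem IsYoung.exists_luxemburg {Φ : ℝ → ℝ} (hΦ : IsYoung Φ) {μ : Measure[m0] Ω} {f : Ω → ℂ}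
    (hf : MemOrlicz μ Φ f) :
    {k : ℝ | 0 < k ∧ ∫⁻ ω, ENNReal.ofReal (Φ (‖f ω‖ / k)) ∂μ ≤ 1}.Nonempty := by
  obtain ⟨-, k, hk, hI⟩ := hf
  set I := ∫⁻ ω, ENNReal.ofReal (Φ (k * ‖f ω‖)) ∂μ
  set r : ℝ := (1 + I.toReal)⁻¹ with hr
  have hI0 : 0 ≤ I.toReal := ENNReal.toReal_nonneg
  have hr0 : 0 < r := by positivity
  have hr1 : r ≤ 1 := inv_le_one_of_one_le₀ (by linarith)
  refine ⟨(r * k)⁻¹, by positivity, ?_⟩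
  calc ∫⁻ ω, ENNReal.ofReal (Φ (‖f ω‖ / (r * k)⁻¹)) ∂μ
      ≤ ∫⁻ ω, ENNReal.ofReal r * ENNReal.ofReal (Φ (k * ‖f ω‖)) ∂μ := by
        refine lintegral_mono fun ω => ?_
        rw [← ENNReal.ofReal_mul hr0.le]
        refine ENNReal.ofReal_le_ofReal ?_
        rw [div_inv_eq_mul, mul_comm, mul_assoc]
        exact hΦ.map_mul_le hr0.le hr1 _
    _ = ENNReal.ofReal r * I := lintegral_const_mul' _ _ ENNReal.ofReal_ne_top
    _ ≤ 1 := by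
        rw [← ENNReal.ofReal_toReal hI.ne, ← ENNReal.ofReal_mul hr0.le, ← ENNReal.ofReal_one]
        refine ENNReal.ofReal_le_ofReal ?_
        rw [hr, inv_mul_le_iff₀ (by positivity)]
        linarith

theorem orliczNorm_le {Φ : ℝ → ℝ} {μ : Measure[m0] Ω} {f : Ω → ℂ} {k : ℝ} (hk : 0 < k)
    (h : ∫⁻ ω, ENNReal.ofReal (Φ (‖f ω‖ / k)) ∂μ ≤ 1) : orliczNorm μ Φ f ≤ k :=
  csInf_le ⟨0, fun _ hx => hx.1.le⟩ ⟨hk, h⟩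

theorem orliczNorm_nonneg (Φ : ℝ → ℝ) (μ : Measure[m0] Ω) (f : Ω → ℂ) :
    0 ≤ orliczNorm μ Φ f := Real.sInf_nonneg fun _ hx => hx.1.le

theorem IsYoung.lintegral_le_one {Φ : ℝ → ℝ} (hΦ : IsYoung Φ) {μ : Measure[m0] Ω} {f : Ω → ℂ}
    (hf : MemOrlicz μ Φ f) {k : ℝ} (hk : orliczNorm μ Φ f < k) :
    ∫⁻ ω, ENNReal.ofReal (Φ (‖f ω‖ / k)) ∂μ ≤ 1 := by
  obtain ⟨l, ⟨hl0, hl⟩, hlk⟩ := exists_lt_of_csInf_lt (hΦ.exists_luxemburg hf) hk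
  refine (lintegral_mono fun ω => ENNReal.ofReal_le_ofReal (hΦ.mono ?_ ?_)).trans hl
  · have := hl0.trans hlk
    positivity
  · gcongr

/-! ### Sufficiency -/

/-- The Hölder inequality localises, so that its second factor only needs a bounded
`Ψ⁻¹(E(Ψ(u)))`. -/
theorem condLExp_enorm_mul_le {Φ : ℝ → ℝ} (hΦ : IsYoung Φ) (hm : m ≤ m0) (μ : Measure[m0] Ω)
    [SigmaFinite (μ.trim hm)] {u : Ω → ℂ} (hu : Measurable[m0] u) {C : ℝ≥0}
    (hC : ∀ f g : Ω → ℂ, MemOrlicz μ Φ f → MemOrlicz μ (complementary Φ) g →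
      ∀ᵐ ω ∂μ, condLExp m μ (fun x => ‖f x * g x‖ₑ) ω ≤
        C * inv Φ (condLExp m μ (comp Φ f) ω) *
          inv (complementary Φ) (condLExp m μ (comp (complementary Φ) g) ω))
    {M : ℝ} (hM0 : 0 ≤ M)
    (hM : ∀ᵐ ω ∂μ, inv (complementary Φ) (condLExp m μ (comp (complementary Φ) u) ω)
      ≤ ENNReal.ofReal M) {f : Ω → ℂ} (hf : MemOrlicz μ Φ f) :
    ∀ᵐ ω ∂μ, condLExp m μ (fun x => ‖u x * f x‖ₑ) ω
      ≤ C * inv Φ (condLExp m μ (comp Φ f) ω) * ENNReal.ofReal M := by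
  -- `E(Ψ(u)) > Ψ(M + 1)` would push the inverse up to `M + 1 > M`. The bound places `u` cut off to
  -- a set of finite measure in `L^Ψ`, where `u` itself may fail to lie.
  have hbd : ∀ᵐ ω ∂μ, condLExp m μ (comp (complementary Φ) u) ω
      ≤ ENNReal.ofReal (complementary Φ (M + 1)) := by
    filter_upwards [hM] with ω hω
    by_contra hlt
    have := (ofReal_le_inv (by linarith) (not_le.1 hlt).le).trans hω
    rw [ENNReal.ofReal_le_ofReal_iff hM0] at this
    linarith
  have hcm : Measurable[m0] (comp (complementary Φ) u) :=
    (hΦ.measurable_complementary.comp hu.norm).ennreal_ofReal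
  have hloc : ∀ n : ℕ, ∀ᵐ ω ∂μ, ω ∈ spanningSets (μ.trim hm) n →
      condLExp m μ (fun x => ‖u x * f x‖ₑ) ω
        ≤ C * inv Φ (condLExp m μ (comp Φ f) ω) * ENNReal.ofReal M := by
    intro n
    set A := spanningSets (μ.trim hm) n with hA
    have hAm : MeasurableSet[m] A := measurableSet_spanningSets _ n
    have hAfin : μ A < ∞ := measure_spanningSets_trim_lt_top hm μ n
    have hind : ∀ G : ℝ → ℝ, G 0 = 0 → comp G (A.indicator u) = A.indicator (comp G u) := by
      intro G hG
      ext x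
      by_cases hx : x ∈ A <;> simp [comp, hx, hG]
    have hmem : MemOrlicz μ (complementary Φ) (A.indicator u) := by
      refine ⟨hu.indicator (hm A hAm), 1, one_pos, ?_⟩
      have : (fun ω => ENNReal.ofReal (complementary Φ (1 * ‖A.indicator u ω‖)))
          = A.indicator (comp (complementary Φ) u) := by
        rw [← hind _ hΦ.complementary_zero]
        ext x
        simp [comp]
      rw [this, lintegral_indicator (hm A hAm), ← setLIntegral_condLExp hm μ _ hAm]
      calc _ ≤ ∫⁻ _ in A, ENNReal.ofReal (complementary Φ (M + 1)) ∂μ :=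
            lintegral_mono_ae (ae_restrict_of_ae hbd)
        _ = ENNReal.ofReal (complementary Φ (M + 1)) * μ A := setLIntegral_const _ _
        _ < ∞ := ENNReal.mul_lt_top ENNReal.ofReal_lt_top hAfin
    have hmono : ∀ᵐ ω ∂μ, condLExp m μ (comp (complementary Φ) (A.indicator u)) ω
        ≤ condLExp m μ (comp (complementary Φ) u) ω := by
      refine condLExp_mono (ae_of_all μ fun x => ?_)
      rw [hind _ hΦ.complementary_zero]
      exact Set.indicator_le_self _ _ x
    have hpull := condLExp_mul_left hm μ (a := A.indicator fun _ => 1)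
      (X := fun x => ‖u x * f x‖ₑ)
      ((@measurable_const _ _ _ m _).indicator hAm)
      (hu.mul hf.1).enorm
    have hfun : (fun x => A.indicator (fun _ => (1 : ℝ≥0∞)) x * ‖u x * f x‖ₑ)
        = fun x => ‖f x * A.indicator u x‖ₑ := by
      ext x
      by_cases hx : x ∈ A <;> simp [hx, mul_comm]
    rw [hfun] at hpull
    filter_upwards [hC f _ hf hmem, hmono, hpull, hM] with ω h1 h2 h3 h4 hω
    rw [h3, Set.indicator_of_mem hω, one_mul] at h1
    exact h1.trans (mul_le_mul_right ((inv_mono h2).trans h4) _)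
  filter_upwards [ae_all_iff.2 hloc] with ω hω
  obtain ⟨n, hn⟩ := Set.mem_iUnion.1
    ((iUnion_spanningSets (μ.trim hm)).symm ▸ Set.mem_univ ω : ω ∈ ⋃ n, spanningSets (μ.trim hm) n)
  exact hω n hn

/-- With `K = 2CM`, the pointwise estimate `Φ(|Tf| / (Kk)) ≤ E(Φ(f/k))` integrates to a comparison
of modulars at every scale `k`. -/
theorem isBoundedOn_of_inv_le {Φ : ℝ → ℝ} (hΦ : IsYoung Φ) (hm : m ≤ m0) (μ : Measure[m0] Ω)
    [SigmaFinite (μ.trim hm)] {u : Ω → ℂ} (hu : Measurable[m0] u) (hE : GenCondHolder m μ Φ)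
    {M : ℝ} (hM0 : 0 < M)
    (hM : ∀ᵐ ω ∂μ, inv (complementary Φ) (condLExp m μ (comp (complementary Φ) u) ω)
      ≤ ENNReal.ofReal M) : IsBoundedOn μ Φ (condMul m μ u) := by
  obtain ⟨C, hC0, hC⟩ := hE
  set K : ℝ := 2 * C * M with hK
  have hK0 : 0 < K := by have : (0 : ℝ) < C := hC0; positivity
  have main : ∀ f : Ω → ℂ, MemOrlicz μ Φ f → ∀ k : ℝ, 0 < k →
      ∫⁻ ω, ENNReal.ofReal (Φ (‖condMul m μ u f ω‖ / (K * k))) ∂μ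
        ≤ ∫⁻ ω, ENNReal.ofReal (Φ (‖f ω‖ / k)) ∂μ := by
    intro f hf k hk
    set g : Ω → ℂ := fun x => ((k⁻¹ : ℝ) : ℂ) * f x with hg
    have hgn : ∀ x, ‖g x‖ = ‖f x‖ / k := fun x => by
      rw [hg, norm_mul, Complex.norm_real, Real.norm_of_nonneg (by positivity), inv_mul_eq_div]
    have hgm : MemOrlicz μ Φ g := by
      obtain ⟨hfm, l, hl, hI⟩ := hf
      refine ⟨hfm.const_mul _, l * k, by positivity, ?_⟩
      have : ∀ ω, l * k * ‖g ω‖ = l * ‖f ω‖ := fun ω => by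
        rw [hgn]
        field_simp
      simpa only [this] using hI
    have hscale := condLExp_mul_left hm μ (a := fun _ => ENNReal.ofReal k)
      (X := fun x => ‖u x * g x‖ₑ) (@measurable_const _ _ _ m _) (hu.mul hgm.1).enorm
    have hfun : (fun x => ENNReal.ofReal k * ‖u x * g x‖ₑ) = fun x => ‖u x * f x‖ₑ := by
      ext x
      rw [← ofReal_norm, ← ofReal_norm, ← ENNReal.ofReal_mul hk.le, norm_mul (u x) (g x),
        norm_mul (u x) (f x), hgn]
      congr 1
      field_simp
    rw [hfun] at hscale
    have hcomp : (fun ω => ENNReal.ofReal (Φ (‖f ω‖ / k))) = comp Φ g := by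
      ext x
      rw [comp, hgn]
    rw [hcomp, ← lintegral_condLExp hm μ (comp Φ g)]
    refine lintegral_mono_ae ?_
    filter_upwards [ofReal_norm_condExpC_le (m := m) μ (fun x => u x * f x), hscale,
      condLExp_enorm_mul_le hΦ hm μ hu hC hM0.le hM hgm] with ω h1 h2 h3
    refine hΦ.ofReal_map_le_of_le_inv (by positivity) ?_
    rw [ENNReal.ofReal_div_of_pos (by positivity)]
    refine ENNReal.div_le_of_le_mul (h1.trans ?_)
    rw [h2]
    calc 2 * (ENNReal.ofReal k * condLExp m μ (fun x => ‖u x * g x‖ₑ) ω)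
        ≤ 2 * (ENNReal.ofReal k * (C * inv Φ (condLExp m μ (comp Φ g) ω) * ENNReal.ofReal M)) := by
          gcongr
      _ = inv Φ (condLExp m μ (comp Φ g) ω) * ENNReal.ofReal (K * k) := by
          rw [hK, ENNReal.ofReal_mul (by positivity), ENNReal.ofReal_mul (by positivity),
            ENNReal.ofReal_mul zero_le_two, ENNReal.ofReal_ofNat, ENNReal.ofReal_coe_nnreal]
          ring
  refine ⟨K, fun f hf => ⟨⟨measurable_condExpC μ _, ?_⟩, ?_⟩⟩
  · obtain ⟨k, hk, hI⟩ := hΦ.exists_luxemburg hf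
    refine ⟨(K * k)⁻¹, by positivity, ?_⟩
    simp only [inv_mul_eq_div]
    exact ((main f hf k hk).trans hI).trans_lt ENNReal.one_lt_top
  · rw [← div_le_iff₀' hK0]
    refine le_csInf (hΦ.exists_luxemburg hf) fun k hk => ?_
    rw [div_le_iff₀' hK0]
    exact orliczNorm_le (mul_pos hK0 hk.1) ((main f hf k hk.1).trans hk.2)

/-! ### Necessity -/

theorem ofReal_indicator_mul (A : Set Ω) {t : ℝ} (ht : 0 ≤ t) (h : Ω → ℝ) (x : Ω) :
    ENNReal.ofReal (A.indicator (fun ω => t * h ω) x)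
      = A.indicator (fun _ => ENNReal.ofReal t) x * ENNReal.ofReal (h x) := by
  by_cases hx : x ∈ A <;> simp [hx, ENNReal.ofReal_mul ht]

theorem condExpC_ofReal_of_nonneg (μ : Measure[m0] Ω) {w : Ω → ℝ} (hw : ∀ ω, 0 ≤ w ω) (ω : Ω) :
    (condLExp m μ (fun x => ENNReal.ofReal (w x)) ω).toReal
      ≤ ‖condExpC m μ (fun x => (w x : ℂ)) ω‖ := by
  have h0 : (fun x => ENNReal.ofReal (-w x)) = 0 := by
    ext x
    simp [hw x]
  refine le_trans (le_of_eq ?_) (Complex.re_le_norm _)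
  simp [condExpC, h0]

/-- A bounded `T` and `Φ ∈ Δ'` give a pointwise bound on `E(|u| f)` for `f` in the unit ball of the
conditional Orlicz class. -/
theorem IsBoundedOn.exists_condLExp_mul_le {Φ : ℝ → ℝ} (hΦ : IsYoung Φ) (hm : m ≤ m0)
    (μ : Measure[m0] Ω) [SigmaFinite (μ.trim hm)] {u : Ω → ℂ} (hu : Measurable[m0] u)
    (hT : WellDefined m μ Φ u) (hΔ : DeltaPrimeGlobally Φ)
    (hB : IsBoundedOn μ Φ (condMul m μ u)) :
    ∃ L : ℝ, 0 < L ∧ ∀ f v : Ω → ℝ, Measurable[m0] f → (∀ ω, 0 ≤ f ω) →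
      (∀ ω, f ω = 0 ∨ v ω = ‖u ω‖) →
      (∀ᵐ ω ∂μ, condLExp m μ (fun x => ENNReal.ofReal (Φ (f x))) ω ≤ 1) →
      ∀ᵐ ω ∂μ, condLExp m μ (fun x => ENNReal.ofReal (v x * f x)) ω ≤ ENNReal.ofReal L := by
  obtain ⟨K, hK⟩ := hB
  obtain ⟨c, hc0, hc⟩ := hΔ
  -- The `+ 1` makes `N_Φ(TF) < K'` strict, as `IsYoung.lintegral_le_one` requires. In `L`, the
  -- factor `2 * max 1 c` is at least `1`, so convexity gives `Φ(tL/K') ≥ 2cΦ(t)`.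
  set K' : ℝ := max K 0 + 1 with hK'
  have hK'0 : 0 < K' := by positivity
  set L : ℝ := K' * (2 * max 1 c) with hL
  have hmax0 : 0 < max 1 c := lt_max_of_lt_left one_pos
  have hL0 : 0 < L := by positivity
  refine ⟨L, hL0, fun f v hf hf0 hfv hE => ?_⟩
  have hvf : (fun x => ENNReal.ofReal (v x * f x)) = fun x => ENNReal.ofReal (‖u x‖ * f x) := by
    ext x
    rcases hfv x with h | h <;> simp [h]
  rw [hvf]
  set e := condLExp m μ (fun x => ENNReal.ofReal (‖u x‖ * f x)) with he
  have hem : Measurable[m] e := measurable_condLExp m μ _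
  by_contra hne
  have hne' : μ {ω | ¬ e ω ≤ ENNReal.ofReal L} ≠ 0 := hne
  obtain ⟨n, hn⟩ : ∃ n, μ ({ω | ¬ e ω ≤ ENNReal.ofReal L} ∩ spanningSets (μ.trim hm) n) ≠ 0 := by
    by_contra hall
    refine hne' ?_
    have := measure_iUnion_null fun n => not_not.1 (not_exists.1 hall n)
    rwa [← Set.inter_iUnion, iUnion_spanningSets, Set.inter_univ] at this
  set A := {ω | ¬ e ω ≤ ENNReal.ofReal L} ∩ spanningSets (μ.trim hm) n with hA
  have hAm : MeasurableSet[m] A :=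
    MeasurableSet.inter (@MeasurableSet.compl _ _ m (hem (measurableSet_Iic (a := ENNReal.ofReal L))))
      (measurableSet_spanningSets _ n)
  have hAfin : μ A < ∞ := (measure_mono Set.inter_subset_right).trans_lt
    (measure_spanningSets_trim_lt_top hm μ n)
  set a : ℝ := (μ A).toReal with ha
  have ha0 : 0 < a := ENNReal.toReal_pos hn hAfin.ne
  have haA : ENNReal.ofReal a = μ A := ENNReal.ofReal_toReal hAfin.ne
  -- Chosen so that `Δ'` gives `∫ Φ(F) ≤ c Φ(t) μ(A) = 1`, while `2cΦ(t) = 2/μ(A)` produces the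
  -- contradiction `2 ≤ 1`.
  obtain ⟨t, ht0, ht⟩ := hΦ.exists_map_eq (a := 1 / (c * a)) (by positivity)
  -- The phase of `u` is cancelled, so that `uF = t|u|f ≥ 0` on `A`; where `u = 0` both sides
  -- vanish.
  set F : Ω → ℂ := A.indicator fun ω => ((t * f ω / ‖u ω‖ : ℝ) : ℂ) * (starRingEnd ℂ) (u ω) with hF
  have hFm : Measurable[m0] F := by
    refine Measurable.indicator ?_ (hm A hAm)
    exact (Complex.measurable_ofReal.comp ((hf.const_mul t).div hu.norm)).mul
      (Complex.continuous_conj.measurable.comp hu)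
  have hFn : ∀ ω, ‖F ω‖ ≤ A.indicator (fun ω => t * f ω) ω := by
    intro ω
    by_cases hω : ω ∈ A
    · rw [hF, Set.indicator_of_mem hω, Set.indicator_of_mem hω, norm_mul, RCLike.norm_conj,
        Complex.norm_real, Real.norm_of_nonneg
          (div_nonneg (mul_nonneg ht0.le (hf0 ω)) (norm_nonneg _))]
      rcases eq_or_ne ‖u ω‖ 0 with h0 | h0
      · simpa [h0] using mul_nonneg ht0.le (hf0 ω)
      · rw [div_mul_cancel₀ _ h0]
    · simp [hF, hω]
  set w : Ω → ℝ := A.indicator fun ω => t * (‖u ω‖ * f ω) with hw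
  have hw0 : ∀ ω, 0 ≤ w ω := fun ω => Set.indicator_nonneg
    (fun x _ => mul_nonneg ht0.le (mul_nonneg (norm_nonneg _) (hf0 x))) ω
  have huF : (fun x => u x * F x) = fun x => (w x : ℂ) := by
    ext x
    by_cases hx : x ∈ A
    · rw [hF, hw, Set.indicator_of_mem hx, Set.indicator_of_mem hx]
      by_cases hux : u x = 0
      · simp [hux]
      · have hun : (‖u x‖ : ℂ) ≠ 0 := by simpa using hux
        rw [mul_left_comm, Complex.mul_conj']
        push_cast
        field_simp
    · simp [hF, hw, hx]
  have hFint : ∫⁻ ω, ENNReal.ofReal (Φ ‖F ω‖) ∂μ ≤ 1 := by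
    calc ∫⁻ ω, ENNReal.ofReal (Φ ‖F ω‖) ∂μ
        ≤ ∫⁻ ω, A.indicator (fun x => ENNReal.ofReal (c * Φ t) * ENNReal.ofReal (Φ (f x))) ω ∂μ := by
          refine lintegral_mono fun ω => ?_
          have h1 := hΦ.mono (norm_nonneg _) (hFn ω)
          by_cases hω : ω ∈ A
          · rw [Set.indicator_of_mem hω] at h1 ⊢
            rw [← ENNReal.ofReal_mul (mul_nonneg hc0.le (hΦ.nonneg t))]
            exact ENNReal.ofReal_le_ofReal (h1.trans (hc t (f ω) ht0.le (hf0 ω)))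
          · rw [Set.indicator_of_notMem hω, hΦ.map_zero] at h1
            simpa [hω] using h1
      _ = ENNReal.ofReal (c * Φ t) *
            ∫⁻ ω in A, condLExp m μ (fun x => ENNReal.ofReal (Φ (f x))) ω ∂μ := by
          rw [lintegral_indicator (hm A hAm), lintegral_const_mul' _ _ ENNReal.ofReal_ne_top,
            setLIntegral_condLExp hm μ _ hAm]
      _ ≤ ENNReal.ofReal (c * Φ t) * ∫⁻ _ in A, 1 ∂μ := by
          exact mul_le_mul_right (lintegral_mono_ae (ae_restrict_of_ae hE)) _
      _ = 1 := by
          rw [setLIntegral_const, one_mul, ← haA, ht,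
            ← ENNReal.ofReal_mul (by positivity), ← ENNReal.ofReal_one]
          congr 1
          field_simp
  have hFmem : MemOrlicz μ Φ F := by
    refine ⟨hFm, 1, one_pos, ?_⟩
    simp only [one_mul]
    exact hFint.trans_lt ENNReal.one_lt_top
  obtain ⟨hTmem, hTn⟩ := hK F hFmem
  have hNF : orliczNorm μ Φ F ≤ 1 := orliczNorm_le one_pos (by simpa using hFint)
  have hNT : orliczNorm μ Φ (condMul m μ u F) < K' := by
    have := orliczNorm_nonneg Φ μ F
    calc _ ≤ K * orliczNorm μ Φ F := hTn
      _ ≤ max K 0 * 1 := mul_le_mul (le_max_left _ _) hNF this (le_max_right _ _)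
      _ < K' := by rw [hK']; linarith
  have hone := hΦ.lintegral_le_one hTmem hNT
  have hlow : ∀ᵐ ω ∂μ, ω ∈ A →
      ENNReal.ofReal (Φ (t * L / K')) ≤ ENNReal.ofReal (Φ (‖condMul m μ u F ω‖ / K')) := by
    have hpull := condLExp_mul_left hm μ (a := A.indicator fun _ => ENNReal.ofReal t)
      (X := fun x => ENNReal.ofReal (‖u x‖ * f x))
      ((@measurable_const _ _ _ m _).indicator hAm) (hu.norm.mul hf).ennreal_ofReal
    -- Finiteness is essential: `toReal` would send an infinite expectation to `0`.
    have hfin := hT F hFmem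
    have hen : (fun x => ‖u x * F x‖ₑ) = fun x => ENNReal.ofReal (w x) := by
      ext x
      rw [congrFun huF x, ← ofReal_norm, Complex.norm_real, Real.norm_of_nonneg (hw0 x)]
    have hww : (fun x => ENNReal.ofReal (w x)) = fun x =>
        A.indicator (fun _ => ENNReal.ofReal t) x * ENNReal.ofReal (‖u x‖ * f x) := by
      ext x
      exact ofReal_indicator_mul A ht0.le _ x
    rw [hen] at hfin
    rw [← hww] at hpull
    filter_upwards [hpull, hfin] with ω h1 h2 hω
    have h3 : t * L ≤ ‖condMul m μ u F ω‖ := by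
      rw [condMul, huF]
      refine le_trans ?_ (condExpC_ofReal_of_nonneg μ hw0 ω)
      rw [← ENNReal.ofReal_le_iff_le_toReal h2.ne, h1, Set.indicator_of_mem hω,
        ENNReal.ofReal_mul ht0.le]
      gcongr
      exact (not_le.1 hω.1).le
    refine ENNReal.ofReal_le_ofReal (hΦ.mono (by positivity) ?_)
    gcongr
  have h2 : (2 : ℝ≥0∞) ≤ 1 := by
    calc (2 : ℝ≥0∞) = ENNReal.ofReal (2 / a) * μ A := by
          rw [← haA, ← ENNReal.ofReal_mul (by positivity), div_mul_cancel₀ _ ha0.ne',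
            ENNReal.ofReal_ofNat]
      _ ≤ ENNReal.ofReal (Φ (t * L / K')) * μ A := by
          gcongr
          have h3 := hΦ.mul_le_map_mul (s := 2 * max 1 c) (by linarith [le_max_left 1 c]) t
          have h4 : t * L / K' = 2 * max 1 c * t := by
            rw [hL]
            field_simp
          rw [h4]
          refine le_trans ?_ h3
          rw [ht]
          calc 2 / a = 2 * c * (1 / (c * a)) := by field_simp
            _ ≤ _ := by gcongr; exact le_max_right _ _
      _ = ∫⁻ _ in A, ENNReal.ofReal (Φ (t * L / K')) ∂μ := (setLIntegral_const _ _).symm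
      _ ≤ ∫⁻ ω in A, ENNReal.ofReal (Φ (‖condMul m μ u F ω‖ / K')) ∂μ :=
          setLIntegral_mono_ae' (hm A hAm) hlow
      _ ≤ 1 := (setLIntegral_le_lintegral _ _).trans hone
  exact absurd h2 (by norm_num)

theorem exists_condLExp_complementary_le {Φ : ℝ → ℝ} (hΦ : IsYoung Φ) (hm : m ≤ m0)
    (μ : Measure[m0] Ω) [SigmaFinite (μ.trim hm)] {u : Ω → ℂ} (hu : Measurable[m0] u)
    (hT : WellDefined m μ Φ u) (hE : GenCondHolder m μ Φ) (hΔ : DeltaPrimeGlobally Φ)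
    (hB : IsBoundedOn μ Φ (condMul m μ u)) :
    ∃ R : ℝ, ∀ᵐ ω ∂μ.trim hm,
      condLExp m μ (comp (complementary Φ) u) ω ≤ ENNReal.ofReal R := by
  obtain ⟨L, hL0, hL⟩ := hB.exists_condLExp_mul_le hΦ hm μ hu hT hΔ
  obtain ⟨C, hC0, hC⟩ := hE
  -- `b` bounds `Ψ⁻¹(1)`; `X` is taken so large that the Hölder bound `LCbX` is absorbed by `Φ(X)`.
  obtain ⟨b, hb0, hb⟩ := hΦ.exists_lt_complementary 1
  obtain ⟨X, hX0, hX⟩ := hΦ.exists_mul_le (L * C * b)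
  have hΨmono : ∀ x y : ℝ, 0 ≤ x → x ≤ y → complementary Φ x ≤ complementary Φ y :=
    fun _ _ => hΦ.complementary_mono
  set S : ℕ → Set Ω := fun n => {ω | ‖u ω‖ ≤ n} ∩ spanningSets (μ.trim hm) n with hS
  have hSm : ∀ n, MeasurableSet[m0] (S n) := fun n =>
    (measurableSet_le hu.norm measurable_const).inter
      (hm _ (measurableSet_spanningSets (μ.trim hm) n))
  have hSfin : ∀ n, μ (S n) < ∞ := fun n => (measure_mono Set.inter_subset_right).trans_lt
    (measure_spanningSets_trim_lt_top hm μ n)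
  have hSmono : Monotone S := fun i j hij =>
    Set.inter_subset_inter (fun ω (hω : ‖u ω‖ ≤ i) => hω.trans (by exact_mod_cast hij))
      (monotone_spanningSets _ hij)
  set v : ℕ → Ω → ℝ := fun n => (S n).indicator fun ω => ‖u ω‖ with hv
  have hvtest : ∀ n, IsTest (S n) (v n) := fun n =>
    ⟨hu.norm.indicator (hSm n), fun ω => Set.indicator_nonneg (fun _ _ => norm_nonneg _) ω,
      ⟨n, fun ω => by
        by_cases hω : ω ∈ S n
        · simpa [hv, hω] using hω.1
        · simp [hv, hω]⟩, fun ω hω => Set.indicator_of_notMem hω _⟩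
  have hfv : ∀ n f, IsTest (S n) f → ∀ ω, f ω = 0 ∨ v n ω = ‖u ω‖ := fun n f hf ω => by
    by_cases hω : ω ∈ S n
    · exact Or.inr (Set.indicator_of_mem hω _)
    · exact Or.inl (hf.eq_zero ω hω)
  have hgtest : ∀ n, IsTest (S n) fun ω => L⁻¹ * v n ω := fun n => by
    obtain ⟨B, hB⟩ := (hvtest n).bounded
    exact ⟨(hvtest n).measurable.const_mul _,
      fun ω => mul_nonneg (inv_nonneg.2 hL0.le) ((hvtest n).nonneg ω),
      ⟨L⁻¹ * B, fun ω => mul_le_mul_of_nonneg_left (hB ω) (inv_nonneg.2 hL0.le)⟩,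
      fun ω hω => by simp [(hvtest n).eq_zero ω hω]⟩
  have hscale : ∀ n f, IsTest (S n) f → ∀ᵐ ω ∂μ,
      condLExp m μ (fun x => ENNReal.ofReal (v n x * f x)) ω
        = ENNReal.ofReal L * condLExp m μ (fun x => ENNReal.ofReal (L⁻¹ * v n x * f x)) ω := by
    intro n f hf
    have := condLExp_mul_left hm μ (a := fun _ => ENNReal.ofReal L)
      (X := fun x => ENNReal.ofReal (L⁻¹ * v n x * f x)) (@measurable_const _ _ _ m _)
      ((hgtest n).measurable.mul hf.measurable).ennreal_ofReal
    have hfun : (fun x => ENNReal.ofReal L * ENNReal.ofReal (L⁻¹ * v n x * f x))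
        = fun x => ENNReal.ofReal (v n x * f x) := by
      ext x
      rw [← ENNReal.ofReal_mul hL0.le, mul_assoc, mul_inv_cancel_left₀ hL0.ne']
    rwa [hfun] at this
  have hunit : ∀ n, ∀ᵐ ω ∂μ,
      condLExp m μ (fun x => ENNReal.ofReal (complementary Φ (L⁻¹ * v n x))) ω
        ≤ ENNReal.ofReal 1 := by
    intro n
    refine hΦ.condLExp_complementary_le hm μ (hSfin n) (hSm n) (hgtest n) one_pos ?_
    intro f hf hf1
    rw [ENNReal.ofReal_one] at hf1
    filter_upwards [hL f (v n) hf.measurable hf.nonneg (hfv n f hf) hf1, hscale n f hf]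
      with ω h1 h2
    rw [h2] at h1
    have hL' : ENNReal.ofReal L ≠ 0 := by simpa using hL0
    rw [ENNReal.ofReal_one]
    exact (ENNReal.mul_le_mul_iff_right hL' ENNReal.ofReal_ne_top).1 (by simpa using h1)
  -- The second use of duality, now at level `Φ(X)`, where Hölder with `v/L` supplies the
  -- hypothesis. The bound does not depend on `n`.
  have hbound : ∀ n, ∀ᵐ ω ∂μ,
      condLExp m μ (fun x => ENNReal.ofReal (complementary Φ (v n x))) ω
        ≤ ENNReal.ofReal (Φ X) := by
    intro n
    refine hΦ.condLExp_complementary_le hm μ (hSfin n) (hSm n) (hvtest n) (hΦ.pos hX0.ne') ?_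
    intro f hf hfX
    have hcomp : ∀ (G : ℝ → ℝ) (h : Ω → ℝ), IsTest (S n) h →
        comp G (fun ω => (h ω : ℂ)) = fun ω => ENNReal.ofReal (G (h ω)) := by
      intro G h hh
      ext x
      rw [comp, Complex.norm_real, Real.norm_of_nonneg (hh.nonneg x)]
    have hH := hC _ _ (hf.memOrlicz hΦ.map_zero (fun _ _ => hΦ.mono) (hSfin n) (hSm n))
      ((hgtest n).memOrlicz hΦ.complementary_zero hΨmono (hSfin n) (hSm n))
    have hen : (fun x => ‖(f x : ℂ) * ((L⁻¹ * v n x : ℝ) : ℂ)‖ₑ)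
        = fun x => ENNReal.ofReal (L⁻¹ * v n x * f x) := by
      ext x
      rw [← ofReal_norm, ← Complex.ofReal_mul, Complex.norm_real, mul_comm,
        Real.norm_of_nonneg (mul_nonneg ((hgtest n).nonneg x) (hf.nonneg x))]
    rw [hen, hcomp _ _ hf, hcomp _ _ (hgtest n)] at hH
    filter_upwards [hH, hscale n f hf, hfX, hunit n] with ω h1 h2 h3 h4
    have h5 : inv Φ (condLExp m μ (fun x => ENNReal.ofReal (Φ (f x))) ω) ≤ ENNReal.ofReal X :=
      (inv_mono h3).trans (hΦ.inv_map_le hX0.le)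
    have h6 : inv (complementary Φ)
        (condLExp m μ (fun x => ENNReal.ofReal (complementary Φ (L⁻¹ * v n x))) ω)
          ≤ ENNReal.ofReal b := by
      refine (inv_mono h4).trans (inv_le_of_forall fun x hx => ?_)
      have hlt := hb.trans_le (hΦ.complementary_mono hb0 hx.le)
      exact (ENNReal.ofReal_lt_ofReal_iff (one_pos.trans hlt)).2 hlt
    rw [h2]
    calc _ ≤ ENNReal.ofReal L * (C * ENNReal.ofReal X * ENNReal.ofReal b) := by
          gcongr
          exact h1.trans (by gcongr)
      _ = ENNReal.ofReal (L * C * b * X) := by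
          rw [← ENNReal.ofReal_coe_nnreal, ← ENNReal.ofReal_mul C.coe_nonneg, ← ENNReal.ofReal_mul
            (mul_nonneg C.coe_nonneg hX0.le), ← ENNReal.ofReal_mul hL0.le]
          congr 1
          ring
      _ ≤ _ := ENNReal.ofReal_le_ofReal (hX X le_rfl)
  have hvmono : ∀ ω, Monotone fun n => v n ω := fun ω i j hij =>
    Set.indicator_le_indicator_of_subset (hSmono hij) (fun _ => norm_nonneg _) ω
  have hvle : ∀ n ω, v n ω ≤ ‖u ω‖ := fun n ω =>
    Set.indicator_le_self' (fun _ _ => norm_nonneg _) ω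
  refine ⟨Φ X, condLExp_le_const_of_iSup hm μ
    (X := fun n ω => ENNReal.ofReal (complementary Φ (v n ω)))
    (fun n => (hΦ.measurable_complementary.comp (hvtest n).measurable).ennreal_ofReal)
    (fun i j hij ω => ENNReal.ofReal_le_ofReal
      (hΨmono _ _ ((hvtest i).nonneg ω) (hvmono ω hij))) (fun ω => le_antisymm ?_ ?_) hbound⟩
  · obtain ⟨k, hk⟩ := Set.mem_iUnion.1 ((iUnion_spanningSets (μ.trim hm)).symm ▸
      Set.mem_univ ω : ω ∈ ⋃ n, spanningSets (μ.trim hm) n)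
    obtain ⟨j, hj⟩ := exists_nat_ge ‖u ω‖
    have hω : ω ∈ S (max k j) := ⟨hj.trans (by exact_mod_cast le_max_right k j),
      monotone_spanningSets _ (le_max_left k j) hk⟩
    refine le_trans (le_of_eq ?_)
      (le_iSup (fun n => ENNReal.ofReal (complementary Φ (v n ω))) (max k j))
    simp only [comp, hv, Set.indicator_of_mem hω]
  · exact iSup_le fun n => ENNReal.ofReal_le_ofReal (hΨmono _ _ ((hvtest n).nonneg ω) (hvle n ω))

end OrliczCondExp

/-! ### The equivalence -/

theorem corollary2p2 {Ω : Type*} {m m0 : MeasurableSpace Ω} (hm : m ≤ m0)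
    (μ : @Measure Ω m0) [SigmaFinite (μ.trim hm)]
    (Φ Ψ : ℝ → ℝ) (hΦ : OrliczCondExp.IsYoung Φ) (hΨ : Ψ = OrliczCondExp.complementary Φ)
    (u : Ω → ℂ) (hu : Measurable[m0] u)
    (hT : OrliczCondExp.WellDefined m μ Φ u)
    (hE : OrliczCondExp.GenCondHolder m μ Φ)
    (h : OrliczCondExp.DeltaPrimeGlobally Φ ∨ OrliczCondExp.Weaker Ψ (fun x => x)) :
    OrliczCondExp.IsBoundedOn μ Φ (OrliczCondExp.condMul m μ u) ↔
      MemLp (fun ω => OrliczCondExp.inv Ψ (condLExp m μ (OrliczCondExp.comp Ψ u) ω)) ∞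
        (μ.trim hm) := by
  subst hΨ
  have hΔ : OrliczCondExp.DeltaPrimeGlobally Φ := h.resolve_right hΦ.not_weaker_complementary
  have hmeas : Measurable[m] fun ω => OrliczCondExp.inv (OrliczCondExp.complementary Φ)
      (condLExp m μ (OrliczCondExp.comp (OrliczCondExp.complementary Φ) u) ω) :=
    OrliczCondExp.inv_mono.measurable.comp (measurable_condLExp m μ _)
  constructor
  · intro hB
    obtain ⟨R, hR⟩ := OrliczCondExp.exists_condLExp_complementary_le hΦ hm μ hu hT hE hΔ hB
    -- The maximum with `0` keeps `Ψ(x)` positive beyond `X`, so the strict inequality survives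
    -- `ENNReal.ofReal`.
    obtain ⟨X, hX0, hX⟩ := hΦ.exists_lt_complementary (max R 0)
    refine ⟨hmeas.aestronglyMeasurable, ?_⟩
    rw [eLpNorm_exponent_top]
    refine eLpNormEssSup_lt_top_of_ae_enorm_bound (C := X.toNNReal) ?_
    filter_upwards [hR] with ω hω
    refine (OrliczCondExp.inv_mono hω).trans (OrliczCondExp.inv_le_of_forall fun x hx => ?_)
    have hlt := hX.trans_le (hΦ.complementary_mono hX0 hx.le)
    exact (ENNReal.ofReal_lt_ofReal_iff ((le_max_right R 0).trans_lt hlt)).2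
      ((le_max_left R 0).trans_lt hlt)
  · intro hLp
    have hlt := hLp.2
    rw [eLpNorm_exponent_top] at hlt
    -- The essential supremum may be `0`; adding `1` makes `M` positive.
    refine OrliczCondExp.isBoundedOn_of_inv_le hΦ hm μ hu hE (M := (eLpNormEssSup
      (fun ω => OrliczCondExp.inv (OrliczCondExp.complementary Φ) (condLExp m μ
        (OrliczCondExp.comp (OrliczCondExp.complementary Φ) u) ω)) (μ.trim hm)).toReal + 1)
      (by positivity) ?_
    filter_upwards [ae_of_ae_trim hm (ae_le_eLpNormEssSup (μ := μ.trim hm)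
      (f := fun ω => OrliczCondExp.inv (OrliczCondExp.complementary Φ) (condLExp m μ
        (OrliczCondExp.comp (OrliczCondExp.complementary Φ) u) ω)))] with ω hω
    rw [enorm_eq_self] at hω
    refine hω.trans ?_
    rw [← ENNReal.ofReal_toReal hlt.ne]
    exact ENNReal.ofReal_le_ofReal (by rw [ENNReal.toReal_ofReal ENNReal.toReal_nonneg]; linarith)
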